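/- Let $\Bbbk$ be a field, $R=\Bbbk[x,y,z]$, $\mathfrak m=(x,y,z)$, and let $I$ be an $\mathfrak m$-primary monomial ideal with $n\ge 4$ minimal monomial generators $m_1,\dots,m_n$, numbered in any fixed order (for instance by the graded reverse lexicographic order). (The condition $n\ge4$ says that $R/I$ is not Gorenstein.) Write $m_{ij}=\operatorname{lcm}(m_i,m_j)$. A monomial $m'$ strongly divides a monomial $m$ if $m'$ divides $m/v$ for every variable $v$ dividing $m$. Assume that $I$ is generic: whenever two distinct minimal generators $m_i,m_j$ have the same positive degree in some variable, there is another minimal generator $m_l$ that strongly divides $m_{ij}$. For $i<j$ let $\sigma_{ij}=\frac{m_{ij}}{m_j}e_j-\frac{m_{ij}}{m_i}e_i\in R^n$, order these elements by the dictionary order on the pairs $(i,j)$, and let $Z_2=\sum_{i<j}R\sigma_{ij}$. Let $S_2$ be the set of those $\sigma_{ij}$ such that (1) $\sigma_{ij}\in Z_2\setminus\mathfrak mZ_2$, and (2) $\sigma_{ij}$ cannot be written as $\sum_{k<l}a_{kl}\sigma_{kl}$ with $a_{kl}\in R$ in such a way that $\sigma_{ij}<\sigma_{kl}$ whenever $a_{kl}\notin\mathfrak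 m$. The maximal ordered resolution of $R/I$ is the minimal free resolution $$0\to R^m\xrightarrow{f_3}R^{S_2}\xrightarrow{f_2}R^n\xrightarrow{[m_1\,\cdots\,m_n]}R\to R/I\to0,$$ graded by monomials ($\mathbb N^3$-graded), in which the columns of $f_2$ are the elements of $S_2$; thus the columns of $f_3$ form an $\mathbb N^3$-homogeneous basis of $\ker f_2$, where the basis vector of $R^{S_2}$ belonging to $\sigma_{ij}$ has degree $m_{ij}$. Then the matrix $f_3$ has at most $n-2$ nonzero entries that lie in $I$. Moreover, there is one minimal generator of $I$ that is a power of a variable such that every nonzero entry of $f_3$ lying in $I$ equals this generator up to a nonzero scalar factor from $\Bbbk$. -/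

import Mathlib

namespace MonomialResolution

/-- The polynomial ring `k[x, y, z]`. A monomial `x^a y^b z^c` is represented by its exponent
vector in `Fin 3 →₀ ℕ`; divisibility of monomials is `≤` and the lcm of monomials is `⊔`. -/
abbrev Poly (k : Type*) [Field k] : Type _ := MvPolynomial (Fin 3) k

/-- The homogeneous maximal ideal `𝔪 = (x, y, z)`. -/
noncomputable def irrelevantIdeal (k : Type*) [Field k] : Ideal (Poly k) :=
  Ideal.span (Set.range (MvPolynomial.X : Fin 3 → Poly k))

/-- `I` is primary to the homogeneous maximal ideal `𝔪`. -/
def IsMaxPrimary {k : Type*} [Field k] (I : Ideal (Poly k)) : Prop :=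
  I.IsPrimary ∧ I.radical = irrelevantIdeal k

/-- `I` is a monomial ideal whose minimal monomial generators are `m_1, …, m_n`, without
repetition, where `m_i` has exponent vector `g i`. -/
structure IsMinimalMonomialGenerators {k : Type*} [Field k] (I : Ideal (Poly k)) {n : ℕ}
    (g : Fin n → (Fin 3 →₀ ℕ)) : Prop where
  /-- the monomials generate `I` -/
  span_eq : Ideal.span (Set.range fun i => (MvPolynomial.monomial (g i) (1 : k))) = I
  /-- none of them divides another one -/
  minimal : ∀ i j, g i ≤ g j → i = j

/-- The monomial `a` strongly divides the monomial `b`: it divides `b / x_t` for every variable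
`x_t` that divides `b`. -/
def StronglyDivides (a b : Fin 3 →₀ ℕ) : Prop :=
  ∀ t, b t ≠ 0 → a ≤ b - Finsupp.single t 1

/-- The monomial ideal with minimal generators `g` is generic: whenever two distinct minimal
generators have the same positive degree in some variable, another minimal generator strongly
divides their lcm. -/
def IsGeneric {n : ℕ} (g : Fin n → (Fin 3 →₀ ℕ)) : Prop :=
  ∀ i j, i ≠ j → (∃ t, g i t = g j t ∧ 0 < g i t) →
    ∃ l, l ≠ i ∧ l ≠ j ∧ StronglyDivides (g l) (g i ⊔ g j)

/-- The pairs of indices `(i, j)` with `i < j`. -/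
abbrev Pair (n : ℕ) : Type := {p : Fin n × Fin n // p.1 < p.2}

/-- The dictionary order on pairs. -/
def Pair.Before {n : ℕ} (p q : Pair n) : Prop :=
  p.1.1 < q.1.1 ∨ (p.1.1 = q.1.1 ∧ p.1.2 < q.1.2)

/-- The exponent vector of `m_{ij} = lcm(m_i, m_j)`. -/
noncomputable def pairLcm {n : ℕ} (g : Fin n → (Fin 3 →₀ ℕ)) (p : Pair n) : Fin 3 →₀ ℕ :=
  g p.1.1 ⊔ g p.1.2

/-- The S-pair `σ_{ij} = (m_{ij} / m_j) e_j - (m_{ij} / m_i) e_i` in `R^n`, for `i < j`. -/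
noncomputable def sPair (k : Type*) [Field k] {n : ℕ} (g : Fin n → (Fin 3 →₀ ℕ)) (p : Pair n) :
    Fin n → Poly k :=
  Pi.single p.1.2 (MvPolynomial.monomial (pairLcm g p - g p.1.2) 1) -
    Pi.single p.1.1 (MvPolynomial.monomial (pairLcm g p - g p.1.1) 1)

/-- The module `Z_2 ⊆ R^n` of second syzygies, generated by all S-pairs. -/
noncomputable def secondSyzygies (k : Type*) [Field k] {n : ℕ} (g : Fin n → (Fin 3 →₀ ℕ)) :
    Submodule (Poly k) (Fin n → Poly k) :=
  Submodule.span (Poly k) (Set.range (sPair k g))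

/-- `σ_{ij}` is an ordered minimal second syzygy: it lies in `Z_2` but not in `𝔪 Z_2`, and it is
not a linear combination of S-pairs in which every S-pair whose coefficient is a unit (at `𝔪`,
that is, a coefficient outside `𝔪`) comes after `σ_{ij}`. -/
def IsOrderedMinimal (k : Type*) [Field k] {n : ℕ} (g : Fin n → (Fin 3 →₀ ℕ)) (p : Pair n) :
    Prop :=
  (sPair k g p ∈ secondSyzygies k g ∧
    sPair k g p ∉ irrelevantIdeal k • secondSyzygies k g) ∧
  ¬ ∃ a : Pair n → Poly k, sPair k g p = ∑ q, a q • sPair k g q ∧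
      ∀ q, a q ∉ irrelevantIdeal k → p.Before q

/-- The set `S_2` of ordered minimal second syzygies, as a set of pairs `i < j`. -/
abbrev OrderedMinimalPair (k : Type*) [Field k] {n : ℕ} (g : Fin n → (Fin 3 →₀ ℕ)) : Type :=
  {p : Pair n // IsOrderedMinimal k g p}

noncomputable instance orderedMinimalPairFintype (k : Type*) [Field k] {n : ℕ}
    (g : Fin n → (Fin 3 →₀ ℕ)) : Fintype (OrderedMinimalPair k g) :=
  Fintype.ofFinite _

/-- The matrix `f_2` of the maximal ordered resolution: its columns are the elements of `S_2`. -/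
noncomputable def secondMatrix (k : Type*) [Field k] {n : ℕ} (g : Fin n → (Fin 3 →₀ ℕ)) :
    Matrix (Fin n) (OrderedMinimalPair k g) (Poly k) :=
  fun i p => sPair k g p.1 i

/-- `f_3` is the last matrix of the maximal ordered resolution
`0 → R^m → R^{S_2} → R^n → R` of `R / I`, with the matrices `f_3`, `f_2` and `[m_1 … m_n]`.
The resolution is graded by monomials: the basis vector of `R^{S_2}` that belongs to `σ_{ij}` has
degree `m_{ij}`, and each column of `f_3` is homogeneous of some degree `d`, so that its entry in
row `σ_{ij}` is a scalar multiple of the monomial `d / m_{ij}` (and `0` if `m_{ij} ∤ d`).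
Only exactness at `R^m` and `R^{S_2}` is asked for; what happens further right does not involve
`f_3`. -/
structure IsLastMatrix {k : Type*} [Field k] {n : ℕ} (g : Fin n → (Fin 3 →₀ ℕ)) {m : ℕ}
    (f₃ : Matrix (OrderedMinimalPair k g) (Fin m) (Poly k)) : Prop where
  /-- the columns are homogeneous for the grading by monomials -/
  homogeneous : ∀ c, ∃ d : Fin 3 →₀ ℕ, ∀ p, ∃ u : k,
    f₃ p c * MvPolynomial.monomial (pairLcm g p.1) 1 = MvPolynomial.monomial d u
  /-- exactness at `R^m` -/
  injective : Function.Injective f₃.mulVecLin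
  /-- exactness at `R^{S_2}` -/
  exact : Function.Exact f₃.mulVecLin (secondMatrix k g).mulVecLin

end MonomialResolution

/-!
For a generic ideal the minimal free resolution is carried by a simplicial complex (the Scarf
complex), and only the special features of this complex that concern the last matrix are needed.

*The complex.* Call an exponent vector `d` free if no generator strongly divides it. By genericity,
a generator dividing a free `d` is determined by a variable in which it attains `d`
(`IsFree.eq_of_attains`), so at most three generators divide `d`. It follows that `S_2` consists of
the `σ_{ij}` with `m_{ij}` free (`isFree_of_isOrderedMinimal`, `IsFree.isOrderedMinimal`), and these
generate `Z_2` (`exists_mulVecLin_eq_sVec`).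

*The columns of `f_3`.* A homogeneous element of `ker f_2` is a cycle in a graph on the generators
(`IsCycle`). If a generator strongly divides the degree of the cycle, coning off from it shows that
the cycle lies in `𝔪 ker f_2`; hence the degree `d` of a column is free (`IsLastMatrix.isFree`), and
the column is a scalar multiple of the boundary of a triangle of generators, each of which attains
`d` in one variable of its own.

*Entries in `I`.* The entry at an edge is `d` divided by the degree of that edge, a power of the
variable in which the opposite vertex attains `d`. It lies in `I` only if this vertex is a pure power
`x_t ^ a` and the edge avoids `x_t`, and then the entry is `x_t ^ a` up to a scalar
(`IsLastMatrix.exists_isApexEntry`). Two such triangles with apices in different variables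
would force the three pure powers to form a triangle, which a fourth generator excludes
(`IsConeTriangle.apex_variable_eq`). Finally, the bases of the triangles with apex `x_t ^ a` are steps
of a staircase in the plane of the two other variables `x_s` and `x_r`. A step is determined by its
end with the larger `x_s`-exponent (`IsLastMatrix.apexEntry_unique`), and this end is neither the apex
nor the power of `x_r`, which leaves at most `n - 2` of them.
-/

namespace MonomialResolution

open MvPolynomial

variable {k : Type*} [Field k] {n : ℕ} {g : Fin n → (Fin 3 →₀ ℕ)}

/-! ### Free degrees -/

/-- No generator strongly divides the monomial with exponent vector `d`. The truncated subtraction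
in `g l t ≤ d t - 1` encodes "`g l t < d t`, or both exponents vanish". -/
def IsFree (g : Fin n → (Fin 3 →₀ ℕ)) (d : Fin 3 →₀ ℕ) : Prop :=
  ∀ l, ¬ ∀ t, g l t ≤ d t - 1

theorem StronglyDivides.le_sub_one {a b : Fin 3 →₀ ℕ} (h : StronglyDivides a b) (hb : b ≠ 0)
    (t : Fin 3) : a t ≤ b t - 1 := by
  by_cases ht : b t = 0
  · obtain ⟨s, hs⟩ := Finsupp.ne_iff.1 hb
    have := h s hs t
    rw [Finsupp.tsub_apply] at this
    omega
  · have := h t ht t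
    simpa [Finsupp.tsub_apply] using this

/-- Below a free degree, a generator is determined by any variable in which it attains that
degree. -/
theorem IsFree.eq_of_attains {d : Fin 3 →₀ ℕ} (hd : IsFree g d) (hgen : IsGeneric g)
    {i j : Fin n} (hi : g i ≤ d) (hj : g j ≤ d) {t : Fin 3} (hit : g i t = d t)
    (hjt : g j t = d t) (ht : 0 < d t) : i = j := by
  by_contra hij
  obtain ⟨l, -, -, hl⟩ := hgen i j hij ⟨t, hit.trans hjt.symm, hit ▸ ht⟩
  refine hd l fun s => ?_
  have h0 : g i ⊔ g j ≠ 0 := by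
    intro h
    have := DFunLike.congr_fun h t
    simp only [Finsupp.sup_apply, Finsupp.coe_zero, Pi.zero_apply] at this
    omega
  have h1 := hl.le_sub_one h0 s
  have h2 := hi s
  have h3 := hj s
  simp only [Finsupp.sup_apply] at h1
  omega

theorem IsFree.exists_attains {d : Fin 3 →₀ ℕ} (hd : IsFree g d) {l : Fin n} (hl : g l ≤ d) :
    ∃ t, g l t = d t ∧ 0 < d t := by
  have := hd l
  push Not at this
  obtain ⟨t, ht⟩ := this
  have := hl t
  exact ⟨t, by omega, by omega⟩

/-- If the lcm of two generators is free, no third generator divides it. -/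
theorem IsFree.eq_or_eq_of_le_sup (hgen : IsGeneric g) {i j l : Fin n}
    (hd : IsFree g (g i ⊔ g j)) (hl : g l ≤ g i ⊔ g j) : l = i ∨ l = j := by
  obtain ⟨t, ht, hpos⟩ := hd.exists_attains hl
  rcases le_total (g i t) (g j t) with h | h
  · exact .inr (hd.eq_of_attains hgen hl le_sup_right ht (by simp [h]) hpos)
  · exact .inl (hd.eq_of_attains hgen hl le_sup_left ht (by simp [h]) hpos)

theorem sup_lt_sup_of_le_sub_one (hmin : ∀ i j, g i ≤ g j → i = j) {a b l : Fin n} (hab : a ≠ b)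
    (hl : ∀ t, g l t ≤ (g a ⊔ g b) t - 1) : g l ⊔ g a < g a ⊔ g b := by
  have hle : g l ⊔ g a ≤ g a ⊔ g b :=
    sup_le (fun t => (hl t).trans (Nat.sub_le _ _)) le_sup_left
  refine lt_of_le_of_ne hle fun h => hab (hmin b a fun t => ?_).symm
  have h1 := DFunLike.congr_fun h t
  have h2 := hl t
  simp only [Finsupp.sup_apply] at h1 h2
  omega

/-! ### S-pairs and the set `S_2` -/

/-- The S-pair of `m_a` and `m_b` for arbitrary indices; it is antisymmetric in `a` and `b`. -/
noncomputable def sVec (k : Type*) [Field k] (g : Fin n → (Fin 3 →₀ ℕ)) (a b : Fin n) :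
    Fin n → Poly k :=
  Pi.single b (monomial (g a ⊔ g b - g b) 1) - Pi.single a (monomial (g a ⊔ g b - g a) 1)

theorem sVec_self (a : Fin n) : sVec k g a a = 0 := by simp [sVec]

theorem sVec_swap (a b : Fin n) : sVec k g a b = -sVec k g b a := by
  simp [sVec, sup_comm]

theorem monomial_smul_sVec {d : Fin 3 →₀ ℕ} {a b : Fin n} (h : g a ⊔ g b ≤ d) (u : k) :
    (monomial (d - (g a ⊔ g b)) u : Poly k) • sVec k g a b =
      Pi.single b (monomial (d - g b) u) - Pi.single a (monomial (d - g a) u) := by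
  simp only [sVec, smul_sub, ← Pi.single_smul, smul_eq_mul, monomial_mul, mul_one]
  rw [tsub_add_tsub_cancel h le_sup_right, tsub_add_tsub_cancel h le_sup_left]

/-- The Taylor relation among the three S-pairs of a triangle, in any degree divisible by the three
generators. -/
theorem monomial_smul_sVec_triangle {d : Fin 3 →₀ ℕ} {a b l : Fin n} (ha : g a ≤ d) (hb : g b ≤ d)
    (hl : g l ≤ d) :
    (monomial (d - (g a ⊔ g b)) 1 : Poly k) • sVec k g a b =
      (monomial (d - (g l ⊔ g b)) 1 : Poly k) • sVec k g l b -
        (monomial (d - (g l ⊔ g a)) 1 : Poly k) • sVec k g l a := by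
  rw [monomial_smul_sVec (sup_le ha hb), monomial_smul_sVec (sup_le hl hb),
    monomial_smul_sVec (sup_le hl ha)]
  abel

theorem sVec_mem (a b : Fin n) : sVec k g a b ∈ secondSyzygies k g := by
  rcases lt_trichotomy a b with h | rfl | h
  · exact Submodule.subset_span ⟨⟨(a, b), h⟩, rfl⟩
  · rw [sVec_self]; exact zero_mem _
  · rw [sVec_swap]; exact neg_mem (Submodule.subset_span ⟨⟨(b, a), h⟩, rfl⟩)

theorem monomial_mem_irrelevantIdeal {d : Fin 3 →₀ ℕ} (hd : d ≠ 0) (u : k) :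
    (monomial d u : Poly k) ∈ irrelevantIdeal k := by
  rw [irrelevantIdeal, ← Set.image_univ, mem_ideal_span_X_image]
  intro m hm
  obtain rfl : d = m := by
    by_contra h
    simp [coeff_monomial, h] at hm
  obtain ⟨t, ht⟩ := Finsupp.ne_iff.1 hd
  exact ⟨t, trivial, ht⟩

theorem coeff_zero_of_mem_irrelevantIdeal {f : Poly k} (hf : f ∈ irrelevantIdeal k) :
    coeff 0 f = 0 := by
  rw [irrelevantIdeal, ← Set.image_univ, mem_ideal_span_X_image] at hf
  by_contra h
  obtain ⟨t, -, ht⟩ := hf 0 (mem_support_iff.2 h)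
  exact ht rfl

theorem isFree_of_isOrderedMinimal (hmin : ∀ i j, g i ≤ g j → i = j) {p : Pair n}
    (hp : IsOrderedMinimal k g p) : IsFree g (pairLcm g p) := by
  intro l hl
  obtain ⟨⟨a, b⟩, hab⟩ := p
  change a < b at hab
  change ∀ t, g l t ≤ (g a ⊔ g b) t - 1 at hl
  refine hp.1.2 ?_
  have hla := sup_lt_sup_of_le_sub_one hmin hab.ne hl
  have hlb := sup_lt_sup_of_le_sub_one hmin hab.ne' (l := l) (by rwa [sup_comm])
  rw [sup_comm (g b) (g a)] at hlb
  have h := monomial_smul_sVec_triangle (k := k) (d := g a ⊔ g b) (l := l) le_sup_left le_sup_right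
    (le_sup_left.trans hla.le)
  rw [tsub_self, ← one_def, one_smul] at h
  change sVec k g a b ∈ _
  rw [h]
  exact sub_mem
    (Submodule.smul_mem_smul (monomial_mem_irrelevantIdeal (tsub_pos_of_lt hlb).ne' 1) (sVec_mem _ _))
    (Submodule.smul_mem_smul (monomial_mem_irrelevantIdeal (tsub_pos_of_lt hla).ne' 1) (sVec_mem _ _))

/-- An S-pair of free degree is the only S-pair whose degree divides its own, so in any expression
of it through S-pairs its own coefficient is a unit at `𝔪`. -/
theorem IsFree.coeff_notMem (hgen : IsGeneric g) {p : Pair n} (hp : IsFree g (pairLcm g p))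
    {a : Pair n → Poly k} (h : sPair k g p = ∑ q, a q • sPair k g q) :
    a p ∉ irrelevantIdeal k := by
  classical
  intro hap
  have hlt : p.1.1 < p.1.2 := p.2
  have h1 := congrArg (coeff (pairLcm g p - g p.1.2)) (congrFun h p.1.2)
  rw [Finset.sum_apply, coeff_sum, Finset.sum_eq_zero] at h1
  · simp [sPair, hlt.ne'] at h1
  intro q _
  by_cases hqp : q = p
  · subst hqp
    simp only [Pi.smul_apply, smul_eq_mul, sPair, Pi.sub_apply, Pi.single_eq_same,
      Pi.single_eq_of_ne hlt.ne', sub_zero]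
    rw [coeff_mul_monomial', if_pos le_rfl, tsub_self, coeff_zero_of_mem_irrelevantIdeal hap,
      zero_mul]
  have hq : q.1.1 < q.1.2 := q.2
  -- A pair `q ≠ p` through the vertex `p.1.2` has its other end outside the divisors of `m_p`.
  have key : (q.1.1 = p.1.2 ∨ q.1.2 = p.1.2) → ¬ pairLcm g q ≤ pairLcm g p := by
    intro hv hle
    have e1 := hp.eq_or_eq_of_le_sup hgen (le_sup_left.trans hle)
    have e2 := hp.eq_or_eq_of_le_sup hgen (le_sup_right.trans hle)
    apply hqp
    apply Subtype.ext
    apply Prod.ext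
    · rcases e1 with e1 | e1 <;> rcases e2 with e2 | e2 <;> grind
    · rcases e1 with e1 | e1 <;> rcases e2 with e2 | e2 <;> grind
  have hpl : g p.1.2 ≤ pairLcm g p := le_sup_right
  have aux : ∀ c, c = p.1.2 → g c ≤ pairLcm g q → (c = q.1.1 ∨ c = q.1.2) →
      ¬ (pairLcm g q - g c ≤ pairLcm g p - g p.1.2) := by
    rintro c rfl hc hv hle
    refine key (by tauto) ?_
    have := add_le_add_left hle (g p.1.2)
    rwa [tsub_add_cancel_of_le hc, tsub_add_cancel_of_le hpl] at this
  simp only [Pi.smul_apply, smul_eq_mul, sPair, Pi.sub_apply, mul_sub, coeff_sub]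
  have z1 : coeff (pairLcm g p - g p.1.2) (a q * (Pi.single q.1.2
      (monomial (pairLcm g q - g q.1.2) (1 : k)) : Fin n → Poly k) p.1.2) = 0 := by
    by_cases e : p.1.2 = q.1.2
    · rw [e, Pi.single_eq_same, ← e, coeff_mul_monomial', if_neg]
      exact aux _ rfl (e ▸ le_sup_right) (.inr e)
    · rw [Pi.single_eq_of_ne e, mul_zero, coeff_zero]
  have z2 : coeff (pairLcm g p - g p.1.2) (a q * (Pi.single q.1.1
      (monomial (pairLcm g q - g q.1.1) (1 : k)) : Fin n → Poly k) p.1.2) = 0 := by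
    by_cases e : p.1.2 = q.1.1
    · rw [e, Pi.single_eq_same, ← e, coeff_mul_monomial', if_neg]
      exact aux _ rfl (e ▸ le_sup_left) (.inl e)
    · rw [Pi.single_eq_of_ne e, mul_zero, coeff_zero]
  rw [z1, z2, sub_zero]

theorem IsFree.isOrderedMinimal (hgen : IsGeneric g) {p : Pair n} (hp : IsFree g (pairLcm g p)) :
    IsOrderedMinimal k g p := by
  refine ⟨⟨Submodule.subset_span ⟨p, rfl⟩, fun h => ?_⟩, ?_⟩
  · rw [secondSyzygies, Submodule.mem_ideal_smul_span_iff_exists_sum] at h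
    obtain ⟨a, ha, h⟩ := h
    refine hp.coeff_notMem (k := k) hgen (a := a) ?_ (ha p)
    rw [← h, Finsupp.sum_fintype _ _ (by simp)]
  · rintro ⟨a, h, ha⟩
    have := ha p (hp.coeff_notMem hgen h)
    rcases this with h | h
    · exact h.false
    · exact h.2.false

theorem secondMatrix_mulVecLin (v : OrderedMinimalPair k g → Poly k) :
    (secondMatrix k g).mulVecLin v = ∑ p, v p • sPair k g p.1 := by
  ext i
  simp [Matrix.mulVec, dotProduct, secondMatrix, mul_comm]

/-- The ordered minimal second syzygies generate all S-pairs. -/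
theorem exists_mulVecLin_eq_sVec (hmin : ∀ i j, g i ≤ g j → i = j) (hgen : IsGeneric g) :
    ∀ a b : Fin n, ∃ v, (secondMatrix k g).mulVecLin v = sVec k g a b := by
  suffices ∀ d : Fin 3 →₀ ℕ, ∀ a b : Fin n, g a ⊔ g b = d →
      sVec k g a b ∈ LinearMap.range (secondMatrix k g).mulVecLin from fun a b => this _ a b rfl
  classical
  intro d
  induction d using WellFoundedLT.induction with
  | ind d ih =>
  intro a b hd
  subst hd
  by_cases hab : a = b
  · subst hab; rw [sVec_self]; exact zero_mem _
  have single_mem : ∀ q : OrderedMinimalPair k g,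
      sPair k g q.1 ∈ LinearMap.range (secondMatrix k g).mulVecLin := fun q =>
    ⟨Pi.single q 1, by rw [secondMatrix_mulVecLin]; simp [Pi.single_apply]⟩
  by_cases hf : IsFree g (g a ⊔ g b)
  · rcases lt_or_gt_of_ne hab with h | h
    · exact single_mem ⟨⟨(a, b), h⟩, IsFree.isOrderedMinimal hgen hf⟩
    · rw [sVec_swap]
      rw [sup_comm] at hf
      exact neg_mem (single_mem ⟨⟨(b, a), h⟩, IsFree.isOrderedMinimal hgen hf⟩)
  · unfold IsFree at hf
    push Not at hf
    obtain ⟨l, hl⟩ := hf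
    have hla := sup_lt_sup_of_le_sub_one hmin hab hl
    have hlb := sup_lt_sup_of_le_sub_one hmin (Ne.symm hab) (l := l) (by rwa [sup_comm])
    rw [sup_comm (g b) (g a)] at hlb
    have h := monomial_smul_sVec_triangle (k := k) (d := g a ⊔ g b) (l := l) le_sup_left
      le_sup_right (le_sup_left.trans hla.le)
    rw [tsub_self, ← one_def, one_smul] at h
    rw [h]
    exact sub_mem (Submodule.smul_mem _ _ (ih _ hlb _ _ rfl))
      (Submodule.smul_mem _ _ (ih _ hla _ _ rfl))

/-! ### Homogeneous syzygies as cycles of a graph -/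

/-- The incidence number of the edge `p`, oriented from `p.1.1` to `p.1.2`, and the vertex `a`. -/
def incidence (k : Type*) [Field k] (p : Pair n) (a : Fin n) : k :=
  (if p.1.2 = a then 1 else 0) - (if p.1.1 = a then 1 else 0)

theorem incidence_fst (p : Pair n) : incidence k p p.1.1 = -1 := by
  simp [incidence, p.2.ne']

theorem incidence_snd (p : Pair n) : incidence k p p.1.2 = 1 := by
  simp [incidence, p.2.ne]

theorem eq_or_eq_of_incidence_ne_zero {p : Pair n} {a : Fin n} (h : incidence k p a ≠ 0) :
    p.1.1 = a ∨ p.1.2 = a := by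
  by_contra hc
  push Not at hc
  simp [incidence, hc.1, hc.2] at h

/-- The elements of degree `d` of the kernel of `f_2`, seen through their scalar coefficients `u`:
they are the cycles of the graph whose edges are the ordered minimal pairs of degree dividing `d`. -/
structure IsCycle (g : Fin n → (Fin 3 →₀ ℕ)) (d : Fin 3 →₀ ℕ) (u : OrderedMinimalPair k g → k) :
    Prop where
  le : ∀ p, u p ≠ 0 → pairLcm g p.1 ≤ d
  vertex : ∀ a, ∑ p, u p * incidence k p.1 a = 0

/-- The element of `R^{S_2}`, homogeneous of degree `d`, with scalar coefficients `u`. -/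
noncomputable def homogeneousVec (d : Fin 3 →₀ ℕ) (u : OrderedMinimalPair k g → k) :
    OrderedMinimalPair k g → Poly k :=
  fun p => monomial (d - pairLcm g p.1) (u p)

theorem isCycle_of_mulVecLin_eq_zero {d : Fin 3 →₀ ℕ} {u : OrderedMinimalPair k g → k}
    (hle : ∀ p, u p ≠ 0 → pairLcm g p.1 ≤ d)
    (h : (secondMatrix k g).mulVecLin (homogeneousVec d u) = 0) : IsCycle g d u := by
  classical
  refine ⟨hle, fun a => ?_⟩
  have h1 := congrFun h a
  rw [secondMatrix_mulVecLin, Finset.sum_apply] at h1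
  have h2 : ∀ p, (homogeneousVec d u p • sPair k g p.1) a =
      monomial (d - g a) (u p * incidence k p.1 a) := by
    intro p
    by_cases hu : u p = 0
    · simp [homogeneousVec, hu]
    · have := congrFun (monomial_smul_sVec (k := k) (a := p.1.1.1) (b := p.1.1.2) (hle p hu) (u p)) a
      change (homogeneousVec d u p • sPair k g p.1) a = _ at this
      rw [this, Pi.sub_apply, incidence, mul_sub, map_sub]
      congr 1
      · by_cases e : p.1.1.2 = a
        · subst e; simp
        · simp [e]
      · by_cases e : p.1.1.1 = a
        · subst e; simp
        · simp [e]
  rw [Finset.sum_congr rfl fun p _ => h2 p, ← map_sum] at h1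
  exact monomial_eq_zero.1 h1

theorem IsCycle.sum_smul_sub_eq_zero {d : Fin 3 →₀ ℕ} {u : OrderedMinimalPair k g → k}
    (h : IsCycle g d u) {M : Type*} [AddCommGroup M] [Module k M] (w : Fin n → M) :
    ∑ p, u p • (w p.1.1.2 - w p.1.1.1) = 0 := by
  have h1 : ∀ p : OrderedMinimalPair k g, u p • (w p.1.1.2 - w p.1.1.1) =
      ∑ a, (u p * incidence k p.1 a) • w a := by
    intro p
    simp [mul_smul, ← Finset.smul_sum, incidence, sub_smul, Finset.sum_sub_distrib, ite_smul]
  rw [Finset.sum_congr rfl fun p _ => h1 p, Finset.sum_comm]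
  simp [← Finset.sum_smul, h.vertex]

theorem IsCycle.linearCombination {d : Fin 3 →₀ ℕ} {u v : OrderedMinimalPair k g → k}
    (hu : IsCycle g d u) (hv : IsCycle g d v) (x y : k) :
    IsCycle g d fun p => x * u p - y * v p := by
  refine ⟨fun p hp => ?_, fun a => ?_⟩
  · by_contra hle
    have h1 : u p = 0 := by_contra fun h => hle (hu.le p h)
    have h2 : v p = 0 := by_contra fun h => hle (hv.le p h)
    simp [h1, h2] at hp
  · simp [sub_mul, mul_assoc, Finset.sum_sub_distrib, ← Finset.mul_sum, hu.vertex, hv.vertex]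

/-- A cycle that enters a vertex along one edge leaves it along another one. -/
theorem IsCycle.exists_ne_edge {d : Fin 3 →₀ ℕ} {u : OrderedMinimalPair k g → k}
    (h : IsCycle g d u) {p : OrderedMinimalPair k g} (hp : u p ≠ 0) {a : Fin n}
    (ha : p.1.1.1 = a ∨ p.1.1.2 = a) :
    ∃ q, q ≠ p ∧ u q ≠ 0 ∧ (q.1.1.1 = a ∨ q.1.1.2 = a) := by
  classical
  by_contra hc
  push Not at hc
  have h1 := h.vertex a
  rw [Finset.sum_eq_single p] at h1
  · rcases mul_eq_zero.1 h1 with h1 | h1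
    · exact hp h1
    · rcases ha with rfl | rfl
      · simp [incidence_fst] at h1
      · simp [incidence_snd] at h1
  · intro q _ hqp
    by_contra hne
    obtain ⟨hq, hi⟩ := mul_ne_zero_iff.1 hne
    have := hc q hqp hq
    rcases eq_or_eq_of_incidence_ne_zero hi with h' | h'
    · exact this.1 h'
    · exact this.2 h'
  · simp

theorem pair_eq_of_same_ends {p q : OrderedMinimalPair k g} {a b : Fin n} (hab : a ≠ b)
    (hpa : p.1.1.1 = a ∨ p.1.1.2 = a) (hpb : p.1.1.1 = b ∨ p.1.1.2 = b)
    (hqa : q.1.1.1 = a ∨ q.1.1.2 = a) (hqb : q.1.1.1 = b ∨ q.1.1.2 = b) : p = q := by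
  have h1 : p.1.1.1 < p.1.1.2 := p.1.2
  have h2 : q.1.1.1 < q.1.1.2 := q.1.2
  apply Subtype.ext
  apply Subtype.ext
  apply Prod.ext <;> grind

/-- A nonzero cycle passes through a third vertex next to each of its edges. -/
theorem IsCycle.exists_third {d : Fin 3 →₀ ℕ} {u : OrderedMinimalPair k g → k}
    (h : IsCycle g d u) {p : OrderedMinimalPair k g} (hp : u p ≠ 0) :
    ∃ i, i ≠ p.1.1.1 ∧ i ≠ p.1.1.2 ∧ g i ≤ d := by
  obtain ⟨q, hqp, hq, ha⟩ := h.exists_ne_edge hp (.inl rfl)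
  have hlt : q.1.1.1 < q.1.1.2 := q.1.2
  have hpl : p.1.1.1 < p.1.1.2 := p.1.2
  have hle := h.le q hq
  rcases ha with ha | ha
  · refine ⟨q.1.1.2, ha ▸ hlt.ne', fun hb => hqp ?_, le_sup_right.trans hle⟩
    exact pair_eq_of_same_ends hpl.ne (.inl ha) (.inr hb) (.inl rfl) (.inr rfl)
  · refine ⟨q.1.1.1, ha ▸ hlt.ne, fun hb => ?_, le_sup_left.trans hle⟩
    exact absurd (hb ▸ ha ▸ hlt : p.1.1.2 < p.1.1.1) hpl.not_gt

/-- A cycle supported on a triangle vanishes as soon as it vanishes on one edge. -/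
theorem IsCycle.eq_zero_of_triangle {d : Fin 3 →₀ ℕ} {u : OrderedMinimalPair k g → k}
    (h : IsCycle g d u) {p : OrderedMinimalPair k g} (hp : u p = 0) {i : Fin n}
    (hi : ∀ l, g l ≤ d → l = i ∨ l = p.1.1.1 ∨ l = p.1.1.2) : u = 0 := by
  funext q
  by_contra hq
  have hpl : p.1.1.1 < p.1.1.2 := p.1.2
  have ends : ∀ q, u q ≠ 0 → (q.1.1.1 = i ∨ q.1.1.1 = p.1.1.1 ∨ q.1.1.1 = p.1.1.2) ∧
      (q.1.1.2 = i ∨ q.1.1.2 = p.1.1.1 ∨ q.1.1.2 = p.1.1.2) := fun q hq =>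
    ⟨hi _ (le_sup_left.trans (h.le q hq)), hi _ (le_sup_right.trans (h.le q hq))⟩
  have not_p : ∀ q, u q ≠ 0 → ¬ ((q.1.1.1 = p.1.1.1 ∨ q.1.1.2 = p.1.1.1) ∧
      (q.1.1.1 = p.1.1.2 ∨ q.1.1.2 = p.1.1.2)) := fun q hq hc =>
    hq (pair_eq_of_same_ends hpl.ne hc.1 hc.2 (.inl rfl) (.inr rfl) ▸ hp)
  -- Every edge of the cycle joins `i` to an end `a` of `p`; it would be the only one at `a`.
  have through : ∀ q, u q ≠ 0 → q.1.1.1 = i ∨ q.1.1.2 = i := by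
    intro q hq
    have h1 := ends q hq
    have h2 := not_p q hq
    have h3 : q.1.1.1 < q.1.1.2 := q.1.2
    grind
  have h3 : q.1.1.1 < q.1.1.2 := q.1.2
  obtain ⟨a, hai, ha⟩ : ∃ a, a ≠ i ∧ (q.1.1.1 = a ∨ q.1.1.2 = a) := by
    rcases through q hq with e | e
    · exact ⟨_, e ▸ h3.ne', .inr rfl⟩
    · exact ⟨_, e ▸ h3.ne, .inl rfl⟩
  obtain ⟨q', hne, hq', ha'⟩ := h.exists_ne_edge hq ha
  exact hne (pair_eq_of_same_ends hai ha' (through q' hq') ha (through q hq))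

/-! ### Columns of the last matrix -/

section LastMatrix

variable {m : ℕ} {f₃ : Matrix (OrderedMinimalPair k g) (Fin m) (Poly k)}

theorem IsLastMatrix.exists_isCycle (hf₃ : IsLastMatrix g f₃) (c : Fin m) :
    ∃ d u, IsCycle g d u ∧ f₃.mulVecLin (Pi.single c 1) = homogeneousVec d u := by
  obtain ⟨d, h⟩ := hf₃.homogeneous c
  choose u hu using h
  have key : ∀ p, (u p ≠ 0 → pairLcm g p.1 ≤ d) ∧
      f₃ p c = monomial (d - pairLcm g p.1) (u p) := by
    intro p
    have hne : (monomial (pairLcm g p.1) 1 : Poly k) ≠ 0 := by simp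
    by_cases hle : pairLcm g p.1 ≤ d
    · refine ⟨fun _ => hle, mul_right_cancel₀ hne ?_⟩
      rw [hu p, monomial_mul, tsub_add_cancel_of_le hle, mul_one]
    · have h0 := congrArg (coeff d) (hu p)
      rw [coeff_mul_monomial', if_neg hle, coeff_monomial, if_pos rfl] at h0
      have h1 := hu p
      rw [← h0, map_zero, mul_eq_zero, or_iff_left hne] at h1
      rw [← h0, map_zero, h1]
      simp
  have hcol : f₃.mulVecLin (Pi.single c 1) = homogeneousVec d u := by
    funext p
    simp [homogeneousVec, ← (key p).2]
  refine ⟨d, u, isCycle_of_mulVecLin_eq_zero (fun p => (key p).1) ?_, hcol⟩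
  rw [← hcol]
  exact (hf₃.exact _).2 ⟨_, rfl⟩

/-- If some generator `m_l` strongly divides the degree of a cycle, the cone over the cycle with
apex `m_l` writes it as a combination, with coefficients in `𝔪`, of elements of the kernel of `f_2`.
A column of `f_3` is part of a basis of that kernel, so this cannot happen for its degree. -/
theorem IsLastMatrix.isFree (hmin : ∀ i j, g i ≤ g j → i = j) (hgen : IsGeneric g)
    (hf₃ : IsLastMatrix g f₃) {c : Fin m} {d : Fin 3 →₀ ℕ} {u : OrderedMinimalPair k g → k}
    (hu : IsCycle g d u) (hcol : f₃.mulVecLin (Pi.single c 1) = homogeneousVec d u) :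
    IsFree g d := by
  classical
  intro l hl
  have hld : g l ≤ d := fun t => (hl t).trans (Nat.sub_le _ _)
  choose v hv using exists_mulVecLin_eq_sVec (k := k) hmin hgen
  -- The boundary of the triangle on `m_l` and the edge `p`, in its own degree.
  let e : OrderedMinimalPair k g → (Fin 3 →₀ ℕ) := fun p => g l ⊔ pairLcm g p.1
  let τ : OrderedMinimalPair k g → (OrderedMinimalPair k g → Poly k) := fun p =>
    (monomial (e p - pairLcm g p.1) 1 : Poly k) • Pi.single p 1 -
      ((monomial (e p - (g l ⊔ g p.1.1.2)) 1 : Poly k) • v l p.1.1.2 -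
        (monomial (e p - (g l ⊔ g p.1.1.1)) 1 : Poly k) • v l p.1.1.1)
  have hτ : ∀ p, (secondMatrix k g).mulVecLin (τ p) = 0 := by
    intro p
    have hp : (secondMatrix k g).mulVecLin (Pi.single p 1) = sVec k g p.1.1.1 p.1.1.2 := by
      rw [secondMatrix_mulVecLin]
      simp [Pi.single_apply]
      rfl
    simp only [τ, map_sub, map_smul, hv, hp]
    rw [sub_eq_zero]
    exact monomial_smul_sVec_triangle (le_sup_left.trans le_sup_right)
      (le_sup_right.trans le_sup_right) le_sup_left
  choose y hy using fun p => (hf₃.exact _).1 (hτ p)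
  let w : Fin n → (OrderedMinimalPair k g → Poly k) := fun a =>
    (monomial (d - (g l ⊔ g a)) 1 : Poly k) • v l a
  have hcone : homogeneousVec d u = ∑ p, u p • ((monomial (d - e p) 1 : Poly k) • τ p) := by
    have h1 : ∀ p, u p • ((monomial (d - e p) 1 : Poly k) • τ p) =
        u p • ((monomial (d - pairLcm g p.1) 1 : Poly k) • (Pi.single p 1 : _ → Poly k)) -
          u p • (w p.1.1.2 - w p.1.1.1) := by
      intro p
      by_cases hp : u p = 0
      · simp [hp]
      · have he : e p ≤ d := sup_le hld (hu.le p hp)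
        rw [← smul_sub]
        congr 1
        simp only [τ, w, smul_sub, smul_smul, monomial_mul, mul_one]
        rw [tsub_add_tsub_cancel he le_sup_right,
          tsub_add_tsub_cancel he (sup_le_sup_left le_sup_right _),
          tsub_add_tsub_cancel he (sup_le_sup_left le_sup_left _)]
    rw [Finset.sum_congr rfl fun p _ => h1 p, Finset.sum_sub_distrib, hu.sum_smul_sub_eq_zero,
      sub_zero]
    funext q
    rw [Finset.sum_apply, Finset.sum_eq_single q]
    · simp [homogeneousVec, smul_monomial]
    · intro p _ hpq
      simp [Pi.single_eq_of_ne hpq.symm]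
    · simp
  have hinj : (Pi.single c 1 : Fin m → Poly k) =
      ∑ p, u p • ((monomial (d - e p) 1 : Poly k) • y p) := by
    apply hf₃.injective
    rw [hcol, hcone, map_sum]
    refine Finset.sum_congr rfl fun p _ => ?_
    rw [LinearMap.map_smul_of_tower, map_smul, hy]
  have h0 := congrArg (coeff 0) (congrFun hinj c)
  rw [Pi.single_eq_same, Finset.sum_apply, coeff_sum, Finset.sum_eq_zero] at h0
  · simp at h0
  intro p _
  by_cases hp : u p = 0
  · simp [hp]
  have hne : d - e p ≠ 0 := by
    intro h
    refine isFree_of_isOrderedMinimal hmin p.2 l fun t => ?_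
    have h1 := DFunLike.congr_fun h t
    have h2 := hl t
    simp only [e, Finsupp.tsub_apply, Finsupp.sup_apply, Finsupp.coe_zero, Pi.zero_apply] at h1
    rcases le_total (g l t) (pairLcm g p.1 t) with h3 | h3
    · rw [sup_eq_right.2 h3] at h1
      omega
    · rw [sup_eq_left.2 h3] at h1
      omega
  simp only [Pi.smul_apply, smul_eq_mul, coeff_smul]
  rw [coeff_zero_of_mem_irrelevantIdeal
    (Ideal.mul_mem_right _ _ (monomial_mem_irrelevantIdeal hne 1)), mul_zero]

/-- Two columns whose cycles have the same degree and share an edge of a triangle that contains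
every generator dividing this degree are proportional, hence equal. -/
theorem IsLastMatrix.column_eq (hf₃ : IsLastMatrix g f₃) {c c' : Fin m} {d : Fin 3 →₀ ℕ}
    {u u' : OrderedMinimalPair k g → k} (hu : IsCycle g d u) (hu' : IsCycle g d u')
    (hcol : f₃.mulVecLin (Pi.single c 1) = homogeneousVec d u)
    (hcol' : f₃.mulVecLin (Pi.single c' 1) = homogeneousVec d u')
    {p : OrderedMinimalPair k g} (hp : u' p ≠ 0) {i : Fin n}
    (hi : ∀ l, g l ≤ d → l = i ∨ l = p.1.1.1 ∨ l = p.1.1.2) : c = c' := by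
  classical
  by_contra hcc
  have hz := (hu.linearCombination hu' (u' p) (u p)).eq_zero_of_triangle
    (p := p) (by ring) hi
  have h1 : f₃.mulVecLin ((C (u' p) : Poly k) • Pi.single c 1 - (C (u p) : Poly k) • Pi.single c' 1)
      = f₃.mulVecLin 0 := by
    rw [map_sub, map_smul, map_smul, hcol, hcol', map_zero]
    funext q
    have := congrArg (monomial (d - pairLcm g q.1)) (congrFun hz q)
    simpa [homogeneousVec, C_mul_monomial] using this
  have h2 := congrFun (hf₃.injective h1) c
  simp [Pi.single_eq_of_ne hcc] at h2
  exact hp h2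

end LastMatrix

/-! ### Triangles with a pure power as apex -/

theorem eq_or_eq_or_eq_of_ne {t s r : Fin 3} (hts : t ≠ s) (htr : t ≠ r) (hsr : s ≠ r) (v : Fin 3) :
    v = t ∨ v = s ∨ v = r := by omega

/-- A triangle on generators `m_i`, `m_j`, `m_k` of free degree `d`, whose apex `m_i` is a power of
the variable `x_t` and whose base, from `m_j` to `m_k`, avoids that variable. The degree `d` is
attained by the apex in `x_t`, by `m_j` in `x_s` and by `m_k` in `x_r`. -/
structure IsConeTriangle (g : Fin n → (Fin 3 →₀ ℕ)) (d : Fin 3 →₀ ℕ) (t s r : Fin 3)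
    (i j k : Fin n) : Prop where
  free : IsFree g d
  ts : t ≠ s
  tr : t ≠ r
  sr : s ≠ r
  apex : g i = Finsupp.single t (d t)
  pos_t : 0 < d t
  pos_s : 0 < d s
  pos_r : 0 < d r
  j_t : g j t = 0
  j_s : g j s = d s
  j_r : g j r < d r
  k_t : g k t = 0
  k_s : g k s < d s
  k_r : g k r = d r

namespace IsConeTriangle

variable {d d' : Fin 3 →₀ ℕ} {t s r t' s' r' : Fin 3} {i j l i' j' l' : Fin n}

theorem swap (h : IsConeTriangle g d t s r i j l) : IsConeTriangle g d t r s i l j :=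
  ⟨h.free, h.tr, h.ts, h.sr.symm, h.apex, h.pos_t, h.pos_r, h.pos_s, h.k_t, h.k_r, h.k_s, h.j_t,
    h.j_r, h.j_s⟩

theorem cases (h : IsConeTriangle g d t s r i j l) (v : Fin 3) : v = t ∨ v = s ∨ v = r :=
  eq_or_eq_or_eq_of_ne h.ts h.tr h.sr v

theorem apex_s (h : IsConeTriangle g d t s r i j l) : g i s = 0 := by simp [h.apex, h.ts]

theorem apex_r (h : IsConeTriangle g d t s r i j l) : g i r = 0 := by simp [h.apex, h.tr]

theorem apex_t (h : IsConeTriangle g d t s r i j l) : g i t = d t := by simp [h.apex]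

theorem not_lt (h : IsConeTriangle g d t s r i j l) (a : Fin n) :
    ¬ (g a t < d t ∧ g a s < d s ∧ g a r < d r) := by
  rintro ⟨h1, h2, h3⟩
  refine h.free a fun v => ?_
  rcases h.cases v with rfl | rfl | rfl <;> omega

theorem le_iff (h : IsConeTriangle g d t s r i j l) {a b : Fin 3 →₀ ℕ} :
    a ≤ b ↔ a t ≤ b t ∧ a s ≤ b s ∧ a r ≤ b r := by
  refine ⟨fun hab => ⟨hab t, hab s, hab r⟩, fun hab v => ?_⟩
  rcases h.cases v with rfl | rfl | rfl
  · exact hab.1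
  · exact hab.2.1
  · exact hab.2.2

theorem apex_le (h : IsConeTriangle g d t s r i j l) : g i ≤ d :=
  h.le_iff.2 ⟨h.apex_t.le, by simp [h.apex_s], by simp [h.apex_r]⟩

theorem left_le (h : IsConeTriangle g d t s r i j l) : g j ≤ d :=
  h.le_iff.2 ⟨by simp [h.j_t], h.j_s.le, h.j_r.le⟩

theorem right_le (h : IsConeTriangle g d t s r i j l) : g l ≤ d := h.swap.left_le

/-- No generator other than the apex has an exponent as large in the variable of the apex. -/
theorem lt_of_ne (h : IsConeTriangle g d t s r i j l) (hmin : ∀ i j, g i ≤ g j → i = j) {a : Fin n}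
    (ha : a ≠ i) : g a t < d t := by
  by_contra hc
  refine ha (hmin i a (h.le_iff.2 ⟨?_, ?_, ?_⟩)).symm
  · rw [h.apex_t]; omega
  · simp [h.apex_s]
  · simp [h.apex_r]

/-- Generators dividing the degree of the triangle are among its vertices. -/
theorem vertices (h : IsConeTriangle g d t s r i j l) (hgen : IsGeneric g) {a : Fin n}
    (ha : g a ≤ d) : a = i ∨ a = j ∨ a = l := by
  obtain ⟨v, hv, hpos⟩ := h.free.exists_attains ha
  rcases h.cases v with rfl | rfl | rfl
  · exact .inl (h.free.eq_of_attains hgen ha h.apex_le hv h.apex_t hpos)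
  · exact .inr (.inl (h.free.eq_of_attains hgen ha h.left_le hv h.j_s hpos))
  · exact .inr (.inr (h.free.eq_of_attains hgen ha h.right_le hv h.k_r hpos))

/-- Two cone triangles with apices in different variables would both be the triangle on the three
pure powers, whose degree is not free when there is a fourth generator. -/
theorem false_of_crossing (hn : 3 < n) (hmin : ∀ i j, g i ≤ g j → i = j) (hgen : IsGeneric g)
    (h : IsConeTriangle g d t s r i j l) (h' : IsConeTriangle g d' s t r i' j' l') : False := by
  have b := h.k_t; have b1 := h.k_s; have b2 := h.k_r
  have c := h'.k_t; have c1 := h'.k_s; have c2 := h'.k_r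
  have p1 := h.pos_t; have p2 := h.pos_s; have p3 := h.pos_r
  have q1 := h'.pos_t; have q2 := h'.pos_s; have q3 := h'.pos_r
  have ht : d' t ≤ d t := by
    by_cases e : j' = i
    · rw [← h'.j_s, e, h.apex_t]
    · exact h'.j_s ▸ (h.lt_of_ne hmin e).le
  have hs : d s ≤ d' s := by
    by_cases e : j = i'
    · rw [← h.j_s, e, h'.apex_t]
    · exact h.j_s ▸ (h'.lt_of_ne hmin e).le
  have hr : d r = d' r := by
    have e1 := h.not_lt l'
    have e2 := h'.not_lt l
    omega
  have hll : l = l' := by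
    by_contra hne
    obtain ⟨a, -, -, ha⟩ := hgen l l' hne ⟨r, by omega, by omega⟩
    have h0 : g l ⊔ g l' ≠ 0 := by
      intro h
      have := DFunLike.congr_fun h r
      simp only [Finsupp.sup_apply, Finsupp.coe_zero, Pi.zero_apply] at this
      omega
    have hb := fun v => ha.le_sub_one h0 v
    simp only [Finsupp.sup_apply] at hb
    have := hb t; have := hb s; have := hb r
    exact h.not_lt a (by omega)
  subst hll
  have hs' : d s = d' s := by
    have e1 := h'.not_lt j
    have := h.j_t; have := h.j_s; have := h.j_r
    omega
  obtain ⟨a, ha⟩ : ∃ a, a ∉ ({i, i', l} : Finset (Fin n)) := by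
    by_contra hc
    push Not at hc
    have h1 := Finset.card_le_card (fun a _ => hc a : Finset.univ ⊆ ({i, i', l} : Finset (Fin n)))
    have h2 := Finset.card_le_three (a := i) (b := i') (c := l)
    rw [Finset.card_univ, Fintype.card_fin] at h1
    omega
  simp only [Finset.mem_insert, Finset.mem_singleton, not_or] at ha
  refine h.not_lt a ⟨h.lt_of_ne hmin ha.1, hs' ▸ h'.lt_of_ne hmin ha.2.1, ?_⟩
  by_contra hc
  exact ha.2.2 (hmin l a (h.le_iff.2 ⟨by omega, by omega, by omega⟩)).symm

/-- All cone triangles have their apex in the same variable. -/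
theorem apex_variable_eq (hn : 3 < n) (hmin : ∀ i j, g i ≤ g j → i = j) (hgen : IsGeneric g)
    (h : IsConeTriangle g d t s r i j l) (h' : IsConeTriangle g d' t' s' r' i' j' l') : t = t' := by
  by_contra hne
  wlog hs : s = t' generalizing s r j l
  · exact this h.swap ((h.cases t').resolve_left (Ne.symm hne) |>.resolve_left (Ne.symm hs)).symm
  subst hs
  wlog ht : s' = t generalizing s' r' j' l'
  · exact this h'.swap ((h'.cases t).resolve_left hne |>.resolve_left (Ne.symm ht)).symm
  subst ht
  obtain rfl : r = r' := by
    have := h.cases r'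
    have := h'.tr
    have := h'.sr
    tauto
  exact h.false_of_crossing hn hmin hgen h'

theorem apex_eq (h : IsConeTriangle g d t s r i j l) (h' : IsConeTriangle g d' t s' r' i' j' l')
    (hmin : ∀ i j, g i ≤ g j → i = j) : i = i' := by
  rcases le_total (d t) (d' t) with hd | hd
  · exact hmin _ _ (by rw [h.apex, h'.apex]; simpa using hd)
  · exact (hmin _ _ (by rw [h.apex, h'.apex]; simpa using hd)).symm

/-- The base of a cone triangle is determined by the end at which `x_s` has the larger exponent:
bases are the steps of the staircase formed by the generators without the variable `x_t`. -/
theorem base_eq (h : IsConeTriangle g d t s r i j l) (h' : IsConeTriangle g d' t s r i' j l')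
    (hmin : ∀ i j, g i ≤ g j → i = j) (hgen : IsGeneric g) : d = d' ∧ l = l' := by
  have hs : d s = d' s := by rw [← h.j_s, h'.j_s]
  have ht : d t = d' t := by rw [← h.apex_t, h.apex_eq h' hmin, h'.apex_t]
  have hr : d r = d' r := by
    have e1 := h.not_lt l'
    have e2 := h'.not_lt l
    have := h.k_t; have := h.k_s; have := h.k_r
    have := h'.k_t; have := h'.k_s; have := h'.k_r
    have := h.pos_t
    omega
  have hd : d = d' := by
    ext v
    rcases h.cases v with rfl | rfl | rfl <;> assumption
  subst hd
  exact ⟨rfl, h.free.eq_of_attains hgen h.right_le h'.right_le h.k_r h'.k_r h.pos_r⟩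

end IsConeTriangle

/-- In a triangle of free degree `d`, the quotient of `d` by the degree of an edge can only lie in
the ideal if the opposite vertex is a pure power and the edge avoids its variable. -/
theorem IsFree.exists_isConeTriangle (hgen : IsGeneric g) {d : Fin 3 →₀ ℕ} (hd : IsFree g d)
    {i j l a : Fin n} (hij : i ≠ j) (hil : i ≠ l) (hjl : j ≠ l) (hi : g i ≤ d) (hj : g j ≤ d)
    (hl : g l ≤ d) (ha : g a ≤ d - (g j ⊔ g l)) : ∃ t s r, IsConeTriangle g d t s r i j l := by
  obtain ⟨t, hit, ht⟩ := hd.exists_attains hi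
  obtain ⟨s, hjs, hs⟩ := hd.exists_attains hj
  obtain ⟨r, hlr, hr⟩ := hd.exists_attains hl
  have hts : t ≠ s := by
    rintro rfl; exact hij (hd.eq_of_attains hgen hi hj hit hjs ht)
  have htr : t ≠ r := by
    rintro rfl; exact hil (hd.eq_of_attains hgen hi hl hit hlr ht)
  have hsr : s ≠ r := by
    rintro rfl; exact hjl (hd.eq_of_attains hgen hj hl hjs hlr hs)
  have ha' : ∀ v, g a v ≤ d v - (g j v ⊔ g l v) := ha
  have had : g a ≤ d := ha.trans tsub_le_self
  obtain ⟨v, hav, hv⟩ := hd.exists_attains had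
  -- The exponents of `x_s` and `x_r` in `d` are used up by the edge, so `m_a` is the apex.
  have h1 := ha' t
  have h2 := ha' s
  have h3 := ha' r
  obtain rfl : v = t := by
    rcases eq_or_eq_or_eq_of_ne hts htr hsr v with rfl | rfl | rfl
    · rfl
    · omega
    · omega
  obtain rfl : a = i := hd.eq_of_attains hgen had hi hav hit hv
  have hjr : g j r ≠ d r := fun e => hjl (hd.eq_of_attains hgen hj hl e hlr hr)
  have hls : g l s ≠ d s := fun e => hjl (hd.eq_of_attains hgen hj hl hjs e hs)
  have hjr' := hj r
  have hls' := hl s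
  refine ⟨v, s, r, hd, hts, htr, hsr, ?_, hv, hs, hr, by omega, hjs, by omega, by omega, by omega,
    hlr⟩
  ext w
  rcases eq_or_eq_or_eq_of_ne hts htr hsr w with rfl | rfl | rfl
  · simpa using hav
  · rw [Finsupp.single_eq_of_ne hts.symm]; omega
  · rw [Finsupp.single_eq_of_ne htr.symm]; omega

/-! ### Entries lying in the ideal -/

theorem IsMinimalMonomialGenerators.exists_le_of_monomial_mem {I : Ideal (Poly k)}
    (hg : IsMinimalMonomialGenerators I g) {d : Fin 3 →₀ ℕ} {u : k} (hu : u ≠ 0)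
    (h : (monomial d u : Poly k) ∈ I) : ∃ a, g a ≤ d := by
  rw [← hg.span_eq, Set.range_comp' (fun s => monomial s (1 : k)) g,
    mem_ideal_span_monomial_image] at h
  obtain ⟨_, ⟨a, rfl⟩, ha⟩ := h d (by simp [mem_support_iff, hu])
  exact ⟨a, ha⟩

/-- An ideal primary to `𝔪` has a power of each variable among its minimal generators. -/
theorem IsMinimalMonomialGenerators.exists_pure_power {I : Ideal (Poly k)}
    (hg : IsMinimalMonomialGenerators I g) (hI : IsMaxPrimary I) (t : Fin 3) :
    ∃ i a, 0 < a ∧ g i = Finsupp.single t a := by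
  have hX : (X t : Poly k) ∈ I.radical := by
    rw [hI.2]
    exact Ideal.subset_span ⟨t, rfl⟩
  obtain ⟨N, hN⟩ := hX
  rw [X_pow_eq_monomial] at hN
  obtain ⟨i, hi⟩ := hg.exists_le_of_monomial_mem one_ne_zero hN
  have hsingle : g i = Finsupp.single t (g i t) := by
    ext v
    by_cases hv : v = t
    · subst hv; simp
    · have := hi v
      rw [Finsupp.single_eq_of_ne hv] at this ⊢
      omega
  refine ⟨i, g i t, Nat.pos_of_ne_zero fun h0 => ?_, hsingle⟩
  rw [h0, Finsupp.single_zero] at hsingle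
  refine hI.1.ne_top ((Ideal.eq_top_iff_one _).2 ?_)
  rw [← hg.span_eq]
  exact Ideal.subset_span ⟨i, by simp [hsingle]⟩

/-- The entry of `f_3` in row `p` and column `c` is, up to the factor `v`, the apex `m_i` of a cone
triangle of degree `d` with base from `m_j` to `m_l`; the ends of `p` are `j` and `l`, and `u` is the
cycle of degree `d` which is the column `c`. -/
structure IsApexEntry {m : ℕ} (f₃ : Matrix (OrderedMinimalPair k g) (Fin m) (Poly k))
    (p : OrderedMinimalPair k g) (c : Fin m) (d : Fin 3 →₀ ℕ) (t s r : Fin 3) (i j l : Fin n)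
    (u : OrderedMinimalPair k g → k) : Prop where
  triangle : IsConeTriangle g d t s r i j l
  ends : (p.1.1.1 = j ∧ p.1.1.2 = l) ∨ (p.1.1.1 = l ∧ p.1.1.2 = j)
  cycle : IsCycle g d u
  column : f₃.mulVecLin (Pi.single c 1) = homogeneousVec d u
  ne_zero : u p ≠ 0
  entry : f₃ p c = monomial (g i) (u p)

theorem IsApexEntry.swap {m : ℕ} {f₃ : Matrix (OrderedMinimalPair k g) (Fin m) (Poly k)}
    {p : OrderedMinimalPair k g} {c : Fin m} {d : Fin 3 →₀ ℕ} {t s r : Fin 3} {i j l : Fin n}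
    {u : OrderedMinimalPair k g → k} (h : IsApexEntry f₃ p c d t s r i j l u) :
    IsApexEntry f₃ p c d t r s i l j u :=
  ⟨h.triangle.swap, h.ends.symm, h.cycle, h.column, h.ne_zero, h.entry⟩

theorem IsLastMatrix.exists_isApexEntry {I : Ideal (Poly k)} (hg : IsMinimalMonomialGenerators I g)
    (hgen : IsGeneric g) {m : ℕ} {f₃ : Matrix (OrderedMinimalPair k g) (Fin m) (Poly k)}
    (hf₃ : IsLastMatrix g f₃) {p : OrderedMinimalPair k g} {c : Fin m} (hne : f₃ p c ≠ 0)
    (hmem : f₃ p c ∈ I) : ∃ d t s r i j l u, IsApexEntry f₃ p c d t s r i j l u := by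
  obtain ⟨d, u, hu, hcol⟩ := hf₃.exists_isCycle c
  have hentry : f₃ p c = monomial (d - pairLcm g p.1) (u p) := by
    simpa [homogeneousVec] using congrFun hcol p
  have hup : u p ≠ 0 := fun h => hne (by simp [hentry, h])
  have hfree := hf₃.isFree hg.minimal hgen hu hcol
  obtain ⟨i, hi1, hi2, hi⟩ := hu.exists_third hup
  rw [hentry] at hmem
  obtain ⟨a, ha⟩ := hg.exists_le_of_monomial_mem hup hmem
  have hle := hu.le p hup
  obtain ⟨t, s, r, h⟩ := hfree.exists_isConeTriangle hgen hi1 hi2 (ne_of_lt p.1.2) hi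
    (le_sup_left.trans hle) (le_sup_right.trans hle) ha
  refine ⟨d, t, s, r, i, _, _, u, h, .inl ⟨rfl, rfl⟩, hu, hcol, hup, ?_⟩
  rw [hentry, h.apex]
  refine congrArg (fun e => monomial e (u p)) ?_
  ext v
  have h1 := h.j_t; have h2 := h.k_t; have h3 := h.j_s; have h4 := h.k_r
  rw [Finsupp.tsub_apply, pairLcm, Finsupp.sup_apply]
  rcases h.cases v with rfl | rfl | rfl
  · simp [h1, h2]
  · rw [Finsupp.single_eq_of_ne h.ts.symm]; omega
  · rw [Finsupp.single_eq_of_ne h.tr.symm]; omega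

/-- An apex entry is determined by the end of its base at which `x_s` has the larger exponent. -/
theorem IsLastMatrix.apexEntry_unique (hmin : ∀ i j, g i ≤ g j → i = j) (hgen : IsGeneric g) {m : ℕ}
    {f₃ : Matrix (OrderedMinimalPair k g) (Fin m) (Poly k)} (hf₃ : IsLastMatrix g f₃)
    {p p' : OrderedMinimalPair k g} {c c' : Fin m} {d d' : Fin 3 →₀ ℕ} {t s r : Fin 3}
    {i i' j l l' : Fin n} {u u' : OrderedMinimalPair k g → k}
    (h : IsApexEntry f₃ p c d t s r i j l u) (h' : IsApexEntry f₃ p' c' d' t s r i' j l' u') :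
    p = p' ∧ c = c' := by
  obtain ⟨rfl, rfl⟩ := h.triangle.base_eq h'.triangle hmin hgen
  have hjl : j ≠ l := by
    rintro rfl
    have := h.triangle.k_s
    have := h.triangle.j_s
    omega
  obtain rfl : p = p' := by
    have := h.ends
    have := h'.ends
    exact pair_eq_of_same_ends hjl (by tauto) (by tauto) (by tauto) (by tauto)
  refine ⟨rfl, hf₃.column_eq h.cycle h'.cycle h.column h'.column h'.ne_zero (i := i) fun a ha => ?_⟩
  have := h.triangle.vertices hgen ha
  have := h.ends
  grind

end MonomialResolution

theorem theorem3 {k : Type*} [Field k] {n : ℕ} (hn : 3 < n)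
    (I : Ideal (MonomialResolution.Poly k)) (g : Fin n → (Fin 3 →₀ ℕ))
    (hI : MonomialResolution.IsMaxPrimary I)
    (hg : MonomialResolution.IsMinimalMonomialGenerators I g)
    (hgen : MonomialResolution.IsGeneric g)
    {m : ℕ} (f₃ : Matrix (MonomialResolution.OrderedMinimalPair k g) (Fin m)
      (MonomialResolution.Poly k))
    (hf₃ : MonomialResolution.IsLastMatrix g f₃) :
    {e : MonomialResolution.OrderedMinimalPair k g × Fin m |
        f₃ e.1 e.2 ≠ 0 ∧ f₃ e.1 e.2 ∈ I}.ncard ≤ n - 2 ∧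
      ∃ (i : Fin n) (t : Fin 3) (a : ℕ), 0 < a ∧ g i = Finsupp.single t a ∧
        ∀ (p : MonomialResolution.OrderedMinimalPair k g) (c : Fin m),
          f₃ p c ≠ 0 → f₃ p c ∈ I →
            ∃ u : k, u ≠ 0 ∧ f₃ p c = MvPolynomial.monomial (g i) u := by
  classical
  have hmin := hg.minimal
  by_cases hE : ∃ e : MonomialResolution.OrderedMinimalPair k g × Fin m,
      f₃ e.1 e.2 ≠ 0 ∧ f₃ e.1 e.2 ∈ I
  swap
  · push Not at hE
    obtain ⟨i, a, ha, hi⟩ := hg.exists_pure_power hI 0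
    refine ⟨?_, i, 0, a, ha, hi, fun p c h1 h2 => absurd h2 (hE (p, c) h1)⟩
    rw [show {e : MonomialResolution.OrderedMinimalPair k g × Fin m |
        f₃ e.1 e.2 ≠ 0 ∧ f₃ e.1 e.2 ∈ I} = ∅ from
      Set.eq_empty_iff_forall_notMem.2 fun e he => hE e he.1 he.2]
    simp
  obtain ⟨⟨p₀, c₀⟩, h1, h2⟩ := hE
  obtain ⟨d₀, t, s, r, i, j₀, l₀, u₀, h₀⟩ := hf₃.exists_isApexEntry hg hgen h1 h2
  have tri₀ := h₀.triangle
  -- Every entry in the ideal has the same apex, and the ends of its base can be named so that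
  -- `x_s` has the larger exponent at `j`.
  have key : ∀ (p : MonomialResolution.OrderedMinimalPair k g) (c : Fin m),
      f₃ p c ≠ 0 → f₃ p c ∈ I → ∃ j l d u, MonomialResolution.IsApexEntry f₃ p c d t s r i j l u := by
    intro p c h1 h2
    obtain ⟨d, t', s', r', i', j, l, u, h⟩ := hf₃.exists_isApexEntry hg hgen h1 h2
    obtain rfl := tri₀.apex_variable_eq hn hmin hgen h.triangle
    obtain rfl := tri₀.apex_eq h.triangle hmin
    by_cases hs : s' = s
    · subst hs
      obtain rfl : r' = r := by
        have := tri₀.cases r'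
        have := h.triangle.tr
        have := h.triangle.sr
        tauto
      exact ⟨j, l, d, u, h⟩
    · have e1 : s' = r := by
        have := tri₀.cases s'
        have := h.triangle.ts
        tauto
      subst e1
      obtain rfl : r' = s := by
        have := tri₀.cases r'
        have := h.triangle.tr
        have := h.triangle.sr
        tauto
      exact ⟨l, j, d, u, h.swap⟩
  refine ⟨?_, i, t, d₀ t, tri₀.pos_t, tri₀.apex, fun p c h1 h2 => ?_⟩
  · have : Nonempty (Fin n) := ⟨i⟩
    choose! J A D U hJ using key
    obtain ⟨b, a, ha, hb⟩ := hg.exists_pure_power hI r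
    have hbi : b ≠ i := by
      rintro rfl
      have := tri₀.apex_r
      rw [hb, Finsupp.single_eq_same] at this
      omega
    -- The apex and the power of `x_r` are never the end of a base at which `x_s` is larger.
    have hcard : ((Finset.univ \ {b, i} : Finset (Fin n)) : Set (Fin n)).ncard = n - 2 := by
      rw [Set.ncard_coe_finset, Finset.card_sdiff_of_subset (Finset.subset_univ _),
        Finset.card_univ, Fintype.card_fin, Finset.card_pair hbi]
    rw [← hcard]
    refine Set.ncard_le_ncard_of_injOn (fun e => J e.1 e.2) ?_ ?_ (Finset.finite_toSet _)
    · rintro ⟨p, c⟩ ⟨h1, h2⟩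
      have T := (hJ p c h1 h2).triangle
      have h3 := T.j_s
      have h4 := T.pos_s
      simp only [Finset.coe_sdiff, Finset.coe_univ, Finset.coe_insert, Finset.coe_singleton,
        Set.mem_sdiff, Set.mem_univ, true_and, Set.mem_insert_iff, Set.mem_singleton_iff, not_or]
      constructor
      · intro e
        rw [e, hb, Finsupp.single_eq_of_ne T.sr] at h3
        omega
      · intro e
        rw [e, T.apex_s] at h3
        omega
    · rintro ⟨p, c⟩ ⟨h1, h2⟩ ⟨p', c'⟩ ⟨h1', h2'⟩ heq
      have e := hJ p c h1 h2
      have e' := hJ p' c' h1' h2'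
      simp only at heq
      rw [← heq] at e'
      obtain ⟨rfl, rfl⟩ := hf₃.apexEntry_unique hmin hgen e e'
      rfl
  · obtain ⟨j, l, d, u, h⟩ := key p c h1 h2
    exact ⟨u p, h.ne_zero, h.entry⟩
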